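/- All posets are finite. A labeling of a poset $P$ is a bijection $\omega:P\to\{1,\dots,|P|\}$; $P$ is naturally labeled by $\omega$ if $\omega(a)<\omega(b)$ whenever $a$ is covered by $b$ in $P$. A $(P,\omega)$-partition is a map $f$ from $P$ to the positive integers such that $a<_P b$ implies $f(a)\le f(b)$, and $a<_P b$ together with $\omega(a)>\omega(b)$ implies $f(a)<f(b)$. Let $$K_{(P,\omega)}=\sum_{f} x_1^{|f^{-1}(1)|}x_2^{|f^{-1}(2)|}\cdots,$$ the sum being over all $(P,\omega)$-partitions $f$. For a composition $\alpha=(\alpha_1,\dots,\alpha_k)$ of $n$ put $M_\alpha=\sum_{i_1<\dots<i_k}x_{i_1}^{\alpha_1}\cdots x_{i_k}^{\alpha_k}$, $S(\alpha)=\{\alpha_1,\alpha_1+\alpha_2,\dots,\alpha_1+\dots+\alpha_{k-1}\}$ and $F_\alpha=\sum_{\beta} M_\beta$, the last sum being over the compositions $\beta$ of $n$ with $S(\alpha)\subseteq S(\beta)$. The series $K_{(P,\omega)}$ is a finite linear combination of the linearly independent series $F_\alpha$ ($\alpha$ ranging over all compositions), and $\mathrm{supp}_F(P)=\mathrm{supp}_F(P,\omega)$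 denotes the set of compositions $\alpha$ such that $F_\alpha$ has nonzero coefficient in it. For $k\ge 0$ let $c_k(P)$ (resp. $a_k(P)$) be the maximum cardinality of a union of $k$ chains (resp. antichains) of $P$. The chain (resp. antichain) Greene shape of $P$ is the sequence $(\lambda_1,\dots,\lambda_\ell)$ with $\lambda_k=c_k(P)-c_{k-1}(P)$ (resp. $\lambda_k=a_k(P)-a_{k-1}(P)$), where $\ell$ is the largest $k$ with $\lambda_k>0$ (the sequence is empty if $P$ is empty). A sequence $\lambda$ is dominated by a sequence $\mu$, equivalently $\mu$ dominates $\lambda$, if they have the same sum and $\lambda_1+\dots+\lambda_i\le\mu_1+\dots+\mu_i$ for all $i$, where missing entries are read as $0$. **Theorem.** Let $P$ and $Q$ be naturally labeled posets with $\mathrm{supp}_F(P)\subseteq\mathrm{supp}_F(Q)$. Then (a) the antichain Greene shape of $P$ is dominated by the antichain Greene shape of $Q$, and (b) the chain Greene shape of $P$ dominates the chain Greene shape of $Q$. -/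

import Mathlib

/-! ### Labeled posets and `(P, ω)`-partitions

A labeling of a finite poset `P` is a bijection `ω : P ≃ Fin (Fintype.card P)`; only the order of
the labels matters, so the label set `{1, …, |P|}` is replaced by the order-isomorphic
`Fin (Fintype.card P)`. -/

/-- `P` is naturally labeled by `ω` if all edges of its Hasse diagram are weak. -/
def IsNaturalLabeling {P : Type*} [PartialOrder P] [Fintype P]
    (ω : P ≃ Fin (Fintype.card P)) : Prop :=
  ∀ a b : P, a ⋖ b → ω a < ω b

/-- A `(P, ω)`-partition: an order-preserving map to the positive integers that is strict on the
relations `a < b` with `ω a > ω b`. -/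
def IsPPartition {P : Type*} [PartialOrder P] [Fintype P]
    (ω : P ≃ Fin (Fintype.card P)) (f : P → ℕ+) : Prop :=
  (∀ a b : P, a < b → f a ≤ f b) ∧ (∀ a b : P, a < b → ω b < ω a → f a < f b)

/-- The `(P, ω)`-partition enumerator, a formal power series in `x₁, x₂, …`: the coefficient of
`∏ xᵢ ^ mᵢ` is the number of `(P, ω)`-partitions `f` with `|f⁻¹(i)| = mᵢ` for all `i`. -/
noncomputable def partitionEnumerator {P : Type*} [PartialOrder P] [Fintype P]
    (ω : P ≃ Fin (Fintype.card P)) : MvPowerSeries ℕ+ ℚ :=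
  fun m => (Nat.card {f : P → ℕ+ // IsPPartition ω f ∧ ∀ i : ℕ+, Nat.card {a : P // f a = i} = m i} : ℚ)

/-! ### Quasisymmetric functions -/

/-- The monomial quasisymmetric function `M_α = ∑_{i₁ < ⋯ < i_k} x_{i₁}^{α₁} ⋯ x_{i_k}^{α_k}`: the
coefficient of a monomial `m` is the number of sequences `i₁ < ⋯ < i_k` whose term is `m`. -/
noncomputable def monomialQSym {n : ℕ} (α : Composition n) : MvPowerSeries ℕ+ ℚ :=
  fun m => (Nat.card {i : Fin α.length → ℕ+ //
    StrictMono i ∧ ∑ j, Finsupp.single (i j) (α.blocksFun j) = m} : ℚ)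

/-- The set `S(α) = {α₁, α₁ + α₂, …, α₁ + ⋯ + α_{k-1}}` of a composition with `k` parts. -/
def Composition.partialSumSet {n : ℕ} (α : Composition n) : Finset ℕ :=
  (Finset.Ioo 0 α.length).image α.sizeUpTo

/-- The fundamental quasisymmetric function `F_α`, the sum of the `M_β` over the compositions `β`
of `n` with `S(α) ⊆ S(β)`. -/
noncomputable def fundamentalQSym {n : ℕ} (α : Composition n) : MvPowerSeries ℕ+ ℚ :=
  ∑ β : Composition n with α.partialSumSet ⊆ β.partialSumSet, monomialQSym β

/-- `c` is a (necessarily finite) expansion of `K` in the fundamental basis, which is indexed by the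
compositions of all natural numbers. -/
def IsFundamentalExpansion (c : (Σ n : ℕ, Composition n) →₀ ℚ) (K : MvPowerSeries ℕ+ ℚ) : Prop :=
  K = c.sum fun α r => r • fundamentalQSym α.2

/-- The `F`-support of `(P, ω)`: the compositions `α` such that `F_α` has nonzero coefficient in the
`F`-expansion of the `(P, ω)`-partition enumerator. -/
def fundamentalSupport {P : Type*} [PartialOrder P] [Fintype P]
    (ω : P ≃ Fin (Fintype.card P)) : Set (Σ n : ℕ, Composition n) :=
  {α | ∃ c : (Σ n : ℕ, Composition n) →₀ ℚ,
    IsFundamentalExpansion c (partitionEnumerator ω) ∧ c α ≠ 0}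

/-! ### Greene shapes and dominance -/

/-- The maximum cardinality `c_k` of a union of `k` chains of the finite poset `P`. -/
noncomputable def maxChainUnion (P : Type*) [PartialOrder P] [Fintype P] (k : ℕ) : ℕ :=
  sSup {m | ∃ C : Fin k → Set P, (∀ i, IsChain (· ≤ ·) (C i)) ∧ (⋃ i, C i).ncard = m}

/-- The maximum cardinality `a_k` of a union of `k` antichains of the finite poset `P`. -/
noncomputable def maxAntichainUnion (P : Type*) [PartialOrder P] [Fintype P] (k : ℕ) : ℕ :=
  sSup {m | ∃ A : Fin k → Set P, (∀ i, IsAntichain (· ≤ ·) (A i)) ∧ (⋃ i, A i).ncard = m}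

/-- The list `(u₁ - u₀, u₂ - u₁, …, u_ℓ - u_{ℓ-1})`, where `ℓ` is the largest `k ≥ 1` with
`u_k - u_{k-1} > 0` (and the list is empty if there is no such `k`). It is applied to sequences
that are weakly increasing and bounded. -/
noncomputable def differenceShape (u : ℕ → ℕ) : List ℕ :=
  (List.range (sSup {k : ℕ | 1 ≤ k ∧ 0 < u k - u (k - 1)})).map fun k => u (k + 1) - u k

/-- The chain Greene shape of `P`. -/
noncomputable def chainGreeneShape (P : Type*) [PartialOrder P] [Fintype P] : List ℕ :=
  differenceShape (maxChainUnion P)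

/-- The antichain Greene shape of `P`. -/
noncomputable def antichainGreeneShape (P : Type*) [PartialOrder P] [Fintype P] : List ℕ :=
  differenceShape (maxAntichainUnion P)

/-- Dominance order `l ≤ l'` on finite sequences of natural numbers with the same sum: every partial
sum of `l` is at most that of `l'`, sequences being padded with zeros. -/
def DominatedBy (l l' : List ℕ) : Prop :=
  l.sum = l'.sum ∧ ∀ i : ℕ, (l.take i).sum ≤ (l'.take i).sum

/-! For a natural labeling, `K_P` is the sum of the `F_α` over the descent compositions of the
linear extensions of `P` (`isFundamentalExpansion_sum_linearExtension`). All coefficients are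
nonnegative, so nothing cancels, and the support records exactly which descent sets occur
(`mem_fundamentalSupport_iff`).

These descent sets determine every `a_k`. A run of consecutive descents in a linear extension is an
antichain, because `x < y` forces both a later position and a larger label for `y`
(`ncard_runs_le_maxAntichainUnion`). Conversely, a maximum union of `k` antichains, layered by
height, can be written as `k` descending runs of a single linear extension
(`exists_linearExtension_runs`). Hence `a_k` is the largest number of positions covered by `k`
descending runs, and it can only grow with the support. This is (a).

For (b), Greene's min-max formula `c_k = min_j (k j + |P| - a_j)` shows that larger `a_j` give
smaller `c_k`. One inequality is double counting (`maxChainUnion_add_maxAntichainUnion_le`); the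
other is linear programming duality for an assignment problem on `P` with `k` extra points
(`exists_le_maxChainUnion_add_maxAntichainUnion`). -/

/-! ### Greene's duality between chains and antichains -/

/-- Egerváry's theorem: a bipartite graph with integral edge costs that has a perfect matching has
an integral dual solution together with a perfect matching of tight edges. -/
theorem exists_dual_and_tight_perm {α : Type*} [Fintype α] [DecidableEq α] (adm : α → α → Prop)
    (cost : α → α → ℤ) (hcost : ∀ a b, 0 ≤ cost a b)
    (σ₀ : Equiv.Perm α) (hσ₀ : ∀ a, adm a (σ₀ a)) :
    ∃ (p q : α → ℤ) (σ : Equiv.Perm α), (∀ a b, adm a b → p a + q b ≤ cost a b) ∧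
      ∀ a, adm a (σ a) ∧ p a + q (σ a) = cost a (σ a) := by
  classical
  let S : ℤ → Prop := fun z => ∃ p q : α → ℤ, (∀ a b, adm a b → p a + q b ≤ cost a b) ∧
    z = ∑ a, p a + ∑ a, q a
  -- Weak duality: the cost of any admissible permutation bounds all dual values.
  have hb : ∃ b : ℤ, ∀ z, S z → z ≤ b := by
    refine ⟨∑ a, cost a (σ₀ a), ?_⟩
    rintro z ⟨p, q, hpq, rfl⟩
    rw [← Equiv.sum_comp σ₀ q, ← Finset.sum_add_distrib]
    exact Finset.sum_le_sum fun a _ => hpq _ _ (hσ₀ a)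
  have hi : ∃ z, S z := ⟨0, 0, 0, fun a b _ => by simpa using hcost a b, by simp⟩
  obtain ⟨z, ⟨p, q, hpq, hz⟩, hmax⟩ := Int.exists_greatest_of_bdd hb hi
  let t : α → Finset α := fun a => {b | adm a b ∧ p a + q b = cost a b}
  have hall : ∀ s : Finset α, s.card ≤ (s.biUnion t).card := by
    intro s
    by_contra! hs
    -- If Hall's condition failed at `s`, raising `p` by 1 on `s` and lowering `q` by 1 on its tight
    -- neighbours would stay feasible, by integrality, and increase the dual value.
    have := hmax (∑ a, (p a + if a ∈ s then 1 else 0) + ∑ b, (q b - if b ∈ s.biUnion t then 1 else 0))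
      ⟨fun a => p a + if a ∈ s then 1 else 0, fun b => q b - if b ∈ s.biUnion t then 1 else 0, ?_, rfl⟩
    · rw [Finset.sum_add_distrib, Finset.sum_sub_distrib] at this
      simp only [Finset.sum_ite_mem, Finset.univ_inter, Finset.sum_const, nsmul_eq_mul,
        mul_one] at this
      omega
    · intro a b hab
      have h1 := hpq a b hab
      by_cases ha : a ∈ s
      · by_cases hb' : b ∈ s.biUnion t
        · simp only [ha, hb', if_true]; omega
        · simp only [ha, hb', if_true, if_false]
          have : p a + q b ≠ cost a b := fun h =>
            hb' (Finset.mem_biUnion.2 ⟨a, ha, by simp [t, hab, h]⟩)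
          omega
      · simp only [ha, if_false]; split_ifs <;> omega
  obtain ⟨f, hf, hft⟩ := (Finset.all_card_le_biUnion_card_iff_exists_injective t).1 hall
  refine ⟨p, q, Equiv.ofBijective f (Finite.injective_iff_bijective.1 hf), hpq, fun a => ?_⟩
  simpa [t] using hft a

/-- A chain meets each of the antichains at most once. -/
theorem ncard_chain_inter_iUnion_antichain_le {P : Type*} [PartialOrder P] {j : ℕ} {C : Set P} (hC : IsChain (· ≤ ·) C)
    (A : Fin j → Set P) (hA : ∀ i, IsAntichain (· ≤ ·) (A i)) : (C ∩ ⋃ i, A i).ncard ≤ j := by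
  have h : ∀ x : (C ∩ ⋃ i, A i : Set P), ∃ i, (x : P) ∈ A i := fun x => Set.mem_iUnion.1 x.2.2
  choose l hl using h
  have hinj : Function.Injective l := by
    intro x y hxy
    have hy := hl y
    rw [← hxy] at hy
    exact Subtype.ext (subsingleton_of_isChain_of_isAntichain
      (hC.mono (Set.inter_subset_left (t := A (l x)))) ((hA (l x)).subset Set.inter_subset_right)
      ⟨x.2.1, hl x⟩ ⟨y.2.1, hy⟩)
  have := Nat.card_le_card_of_injective l hinj
  rwa [Nat.card_coe_set_eq, Nat.card_fin] at this

section

variable {P : Type*} [PartialOrder P] [Fintype P]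

theorem ncard_le_maxChainUnion {k : ℕ} (C : Fin k → Set P) (hC : ∀ i, IsChain (· ≤ ·) (C i)) :
    (⋃ i, C i).ncard ≤ maxChainUnion P k :=
  le_csSup ⟨Nat.card P, by rintro _ ⟨C, -, rfl⟩; exact Set.ncard_le_card _⟩ ⟨C, hC, rfl⟩

theorem ncard_le_maxAntichainUnion {k : ℕ} (A : Fin k → Set P)
    (hA : ∀ i, IsAntichain (· ≤ ·) (A i)) : (⋃ i, A i).ncard ≤ maxAntichainUnion P k :=
  le_csSup ⟨Nat.card P, by rintro _ ⟨C, -, rfl⟩; exact Set.ncard_le_card _⟩ ⟨A, hA, rfl⟩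

variable (P) in
theorem exists_ncard_eq_maxChainUnion (k : ℕ) :
    ∃ C : Fin k → Set P, (∀ i, IsChain (· ≤ ·) (C i)) ∧ (⋃ i, C i).ncard = maxChainUnion P k :=
  Nat.sSup_mem (s := {m | ∃ C : Fin k → Set P, (∀ i, IsChain (· ≤ ·) (C i)) ∧
      (⋃ i, C i).ncard = m}) ⟨_, fun _ => ∅, fun _ => IsChain.empty, rfl⟩
    ⟨Nat.card P, by rintro _ ⟨C, -, rfl⟩; exact Set.ncard_le_card _⟩

variable (P) in
theorem exists_ncard_eq_maxAntichainUnion (k : ℕ) :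
    ∃ A : Fin k → Set P, (∀ i, IsAntichain (· ≤ ·) (A i)) ∧
      (⋃ i, A i).ncard = maxAntichainUnion P k :=
  Nat.sSup_mem (s := {m | ∃ C : Fin k → Set P, (∀ i, IsAntichain (· ≤ ·) (C i)) ∧
      (⋃ i, C i).ncard = m}) ⟨_, fun _ => ∅, fun _ => IsAntichain.empty, rfl⟩
    ⟨Nat.card P, by rintro _ ⟨C, -, rfl⟩; exact Set.ncard_le_card _⟩

/-- Inclusion-exclusion: the two unions together lie in `P`, and each of the `k` chains meets the
`j` antichains in at most `j` points. -/
theorem maxChainUnion_add_maxAntichainUnion_le (k j : ℕ) :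
    maxChainUnion P k + maxAntichainUnion P j ≤ k * j + Fintype.card P := by
  obtain ⟨C, hC, hCk⟩ := exists_ncard_eq_maxChainUnion P k
  obtain ⟨A, hA, hAj⟩ := exists_ncard_eq_maxAntichainUnion P j
  rw [← hCk, ← hAj, ← Set.ncard_union_add_ncard_inter, add_comm]
  refine add_le_add ?_ ((Set.ncard_le_card _).trans_eq Nat.card_eq_fintype_card)
  rw [Set.iUnion_inter]
  refine (Set.ncard_iUnion_le_of_fintype _).trans ?_
  refine (Finset.sum_le_sum fun i _ => ncard_chain_inter_iUnion_antichain_le (hC i) A hA).trans ?_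
  simp

/-- A permutation of `P ⊕ Fin r` moving elements of `P` upwards, except into `Fin r`, covers the
elements of `P` that it moves by `r` chains. -/
theorem ncard_moved_le_maxChainUnion {r : ℕ} (σ : Equiv.Perm (P ⊕ Fin r))
    (hσ : ∀ u v : P, σ (.inl u) = .inl v → u ≤ v) :
    {v : P | σ (.inl v) ≠ .inl v}.ncard ≤ maxChainUnion P r := by
  let R : P → P → Prop := fun w v => σ (.inl w) = .inl v
  have hR : Relator.RightUnique R := fun a b c hb hc => Sum.inl_injective (hb.symm.trans hc)
  have hle : ∀ a b, Relation.ReflTransGen R a b → a ≤ b := by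
    intro a b h
    induction h with
    | refl => exact le_rfl
    | tail _ h ih => exact ih.trans (hσ _ _ h)
  -- The chain `C i` follows the orbit of the extra point `i` until it next leaves `P`.
  let C : Fin r → Set P := fun i => {v | ∃ w, σ (.inr i) = .inl w ∧ Relation.ReflTransGen R w v}
  have hC : ∀ i, IsChain (· ≤ ·) (C i) := by
    rintro i v ⟨w, hw, hv⟩ v' ⟨w', hw', hv'⟩ -
    obtain rfl : w = w' := Sum.inl_injective (hw.symm.trans hw')
    exact (Relation.ReflTransGen.total_of_right_unique hR hv hv').imp (hle _ _) (hle _ _)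
  refine le_trans (Set.ncard_le_ncard ?_) (ncard_le_maxChainUnion C hC)
  intro v
  induction v using WellFoundedLT.induction with
  | ind v ih =>
    intro hv
    -- Going backwards along `σ`, a moved element comes from a strictly smaller moved element or
    -- from an extra point.
    rcases hw : σ.symm (.inl v) with w | i
    · have hwv : σ (.inl w) = .inl v := by rw [← hw, Equiv.apply_symm_apply]
      have hne : w ≠ v := by rintro rfl; exact hv hwv
      obtain ⟨i, w', h1, h2⟩ := Set.mem_iUnion.1 (ih w (lt_of_le_of_ne (hσ _ _ hwv) hne)
        (fun h => hne (Sum.inl_injective (h.symm.trans hwv))))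
      exact Set.mem_iUnion.2 ⟨i, w', h1, h2.tail hwv⟩
    · exact Set.mem_iUnion.2 ⟨i, v, by rw [← hw, Equiv.apply_symm_apply], .refl⟩

/-- The fibres of a strictly increasing level function are antichains, and only `j` levels are
available on `U`. -/
theorem ncard_le_maxAntichainUnion_of_levels (U : Set P) (l : P → ℤ) (a : ℤ) (j : ℕ)
    (hl : ∀ v ∈ U, a ≤ l v ∧ l v < a + j) (hlt : ∀ u ∈ U, ∀ v ∈ U, u < v → l u < l v) :
    U.ncard ≤ maxAntichainUnion P j := by
  refine le_trans (Set.ncard_le_ncard ?_)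
    (ncard_le_maxAntichainUnion (fun i : Fin j => {v | v ∈ U ∧ l v = a + i}) ?_)
  · intro v hv
    obtain ⟨h1, h2⟩ := hl v hv
    exact Set.mem_iUnion.2 ⟨⟨(l v - a).toNat, by omega⟩, hv, by simp; omega⟩
  · rintro i u ⟨hu, hu'⟩ v ⟨hv, hv'⟩ hne hle
    have := hlt u hu v hv (lt_of_le_of_ne hle hne)
    omega

theorem maxAntichainUnion_card : Fintype.card P ≤ maxAntichainUnion P (Fintype.card P) := by
  let e := Fintype.equivFin P
  refine le_trans ?_ (ncard_le_maxAntichainUnion (fun i => {e.symm i})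
    fun i => IsAntichain.singleton)
  rw [Set.eq_univ_of_forall (s := ⋃ i, {e.symm i}) fun x => Set.mem_iUnion.2 ⟨e x, by simp⟩]
  simp [Set.ncard_univ]

theorem maxChainUnion_card : Fintype.card P ≤ maxChainUnion P (Fintype.card P) := by
  let e := Fintype.equivFin P
  refine le_trans ?_ (ncard_le_maxChainUnion (fun i => {e.symm i}) fun i => IsChain.singleton)
  rw [Set.eq_univ_of_forall (s := ⋃ i, {e.symm i}) fun x => Set.mem_iUnion.2 ⟨e x, by simp⟩]
  simp [Set.ncard_univ]

/-- Greene's min-max theorem for unions of `r` chains. -/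
theorem exists_le_maxChainUnion_add_maxAntichainUnion (r : ℕ) :
    ∃ j, r * j + Fintype.card P ≤ maxChainUnion P r + maxAntichainUnion P j := by
  classical
  -- The case `r = 0` is separate because maxima over `Fin r` are taken below.
  obtain rfl | hr := Nat.eq_zero_or_pos r
  · exact ⟨Fintype.card P, by have := maxAntichainUnion_card (P := P); omega⟩
  have : Nonempty (Fin r) := ⟨⟨0, hr⟩⟩
  -- Only fixed points in `P` cost 1, so a cheap permutation moves many elements of `P`, and the
  -- moved ones are covered by `r` chains.
  let adm : P ⊕ Fin r → P ⊕ Fin r → Prop := fun x y =>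
    ∀ u v : P, x = .inl u → y = .inl v → u ≤ v
  let cost : P ⊕ Fin r → P ⊕ Fin r → ℤ := fun x y => if x = y ∧ x.isLeft then 1 else 0
  obtain ⟨p, q, σ, hpq, hσ⟩ := exists_dual_and_tight_perm adm cost
    (fun a b => by simp only [cost]; split_ifs <;> simp) 1 (by
      rintro a u v rfl h
      exact (Sum.inl_injective h).le)
  obtain ⟨i₀, hi₀⟩ := Finite.exists_max fun i : Fin r => p (.inr i)
  obtain ⟨j₀, hj₀⟩ := Finite.exists_max fun i : Fin r => q (.inr i)
  have hll : ∀ u v : P, u < v → p (.inl u) + q (.inl v) ≤ 0 := by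
    intro u v h
    have := hpq (.inl u) (.inl v) (by rintro _ _ ⟨⟩ ⟨⟩; exact h.le)
    simpa [cost, h.ne] using this
  have hl : ∀ u : P, p (.inl u) + q (.inl u) ≤ 1 := by
    intro u
    have := hpq (.inl u) (.inl u) (by rintro _ _ ⟨⟩ ⟨⟩; exact le_rfl)
    simpa [cost] using this
  have hlr : ∀ (u : P) j, p (.inl u) + q (.inr j) ≤ 0 := by
    intro u j
    simpa [cost] using hpq (.inl u) (.inr j) (by rintro _ _ - ⟨⟩)
  have hrl : ∀ (u : P) j, p (.inr j) + q (.inl u) ≤ 0 := by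
    intro u j
    simpa [cost] using hpq (.inr j) (.inl u) (by rintro _ _ ⟨⟩)
  have hrr : ∀ i j, p (.inr i) + q (.inr j) ≤ 0 := by
    intro i j
    simpa [cost] using hpq (.inr i) (.inr j) (by rintro _ _ ⟨⟩)
  -- On `U`, where the loop constraint is tight, `p` takes values from `1 + p (.inr i₀)` to `-q
  -- (.inr j₀)`, which leaves `j` levels.
  obtain ⟨j, hj⟩ : ∃ j : ℕ, (j : ℤ) = -(p (.inr i₀) + q (.inr j₀)) :=
    ⟨_, Int.toNat_of_nonneg (by have := hrr i₀ j₀; omega)⟩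
  refine ⟨j, ?_⟩
  let U : Finset P := {v | p (.inl v) + q (.inl v) = 1}
  have hU : U.card ≤ maxAntichainUnion P j := by
    rw [← Set.ncard_coe_finset]
    refine ncard_le_maxAntichainUnion_of_levels _ (fun v => p (.inl v)) (1 + p (.inr i₀)) j ?_ ?_
    · intro v hv
      have h1 : p (.inl v) + q (.inl v) = 1 := by simpa [U] using hv
      have := hlr v j₀
      have := hrl v i₀
      constructor <;> omega
    · intro u hu v hv huv
      have h1 : p (.inl v) + q (.inl v) = 1 := by simpa [U] using hv
      have := hll u v huv
      omega
  let V : Finset P := {v | σ (.inl v) ≠ .inl v}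
  have hV : V.card ≤ maxChainUnion P r := by
    rw [← Set.ncard_coe_finset]
    simpa [V] using ncard_moved_le_maxChainUnion σ fun u v h => (hσ (.inl u)).1 u v rfl h
  have hloops : ∑ x, cost x (σ x) = ∑ v : P, if v ∈ V then 0 else 1 := by
    rw [Fintype.sum_sum_type]
    simp only [cost, V, Sum.isLeft_inl, Sum.isLeft_inr]
    simp only [and_true, Bool.false_eq_true, and_false, if_false, Finset.sum_const_zero, add_zero]
    refine Finset.sum_congr rfl fun v _ => ?_
    by_cases h : σ (.inl v) = .inl v
    · simp [h]
    · simp [h, Ne.symm h]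
  have hVc : (∑ v : P, if v ∈ V then (0 : ℤ) else 1) + V.card = Fintype.card P := by
    have : ∀ v : P, (if v ∈ V then (0 : ℤ) else 1) = 1 - if v ∈ V then 1 else 0 := by
      intro v; split_ifs <;> simp
    simp only [this, Finset.sum_sub_distrib, Finset.sum_ite_mem, Finset.univ_inter,
      Finset.sum_const, nsmul_eq_mul, mul_one, Finset.card_univ]
    omega
  have hdual : ∑ x, cost x (σ x) = (∑ v : P, (p (.inl v) + q (.inl v))) +
      ∑ i : Fin r, (p (.inr i) + q (.inr i)) := by
    rw [← Fintype.sum_sum_type fun x => p x + q x, Finset.sum_add_distrib, ← Equiv.sum_comp σ q,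
      ← Finset.sum_add_distrib]
    exact Finset.sum_congr rfl fun x _ => ((hσ x).2).symm
  have h1 : ∑ v : P, (p (.inl v) + q (.inl v)) ≤ U.card := by
    calc _ ≤ ∑ v : P, if v ∈ U then (1 : ℤ) else 0 := by
          refine Finset.sum_le_sum fun v _ => ?_
          have := hl v
          by_cases h : p (.inl v) + q (.inl v) = 1
          · simp [U, h]
          · simp only [U, Finset.mem_filter, Finset.mem_univ, true_and, h, if_false]; omega
      _ = U.card := by simp
  have h2 : ∑ i : Fin r, (p (.inr i) + q (.inr i)) ≤ -(r * j : ℤ) := by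
    calc _ ≤ ∑ i : Fin r, -(j : ℤ) := by
          refine Finset.sum_le_sum fun i _ => ?_
          have := hi₀ i
          have := hj₀ i
          omega
      _ = _ := by simp
  zify
  omega

/-- Domination of antichain unions is reversed for chain unions. -/
theorem maxChainUnion_le_of_maxAntichainUnion_le {Q : Type*} [PartialOrder Q] [Fintype Q]
    (hcard : Fintype.card P = Fintype.card Q)
    (h : ∀ j, maxAntichainUnion P j ≤ maxAntichainUnion Q j) (k : ℕ) :
    maxChainUnion Q k ≤ maxChainUnion P k := by
  obtain ⟨j, hj⟩ := exists_le_maxChainUnion_add_maxAntichainUnion (P := P) k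
  have := maxChainUnion_add_maxAntichainUnion_le (P := Q) k j
  have := h j
  omega

end

/-! ### Partial sums of Greene shapes -/

/-- The sum telescopes, and `u` is constant after its last jump, so cutting the list there loses
nothing. -/
theorem differenceShape_take_sum {u : ℕ → ℕ} (hu : Monotone u) (h0 : u 0 = 0) {N : ℕ}
    (hN : ∀ k, N ≤ k → u k = u N) (i : ℕ) : ((differenceShape u).take i).sum = u i := by
  set S : Set ℕ := {k : ℕ | 1 ≤ k ∧ 0 < u k - u (k - 1)} with hS
  have hbdd : BddAbove S := by
    refine ⟨N, fun k hk => ?_⟩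
    by_contra! h
    have := hN k h.le
    have := hN (k - 1) (by omega)
    have := hk.2
    omega
  have hconst : ∀ d, u (sSup S + d) = u (sSup S) := by
    intro d
    induction d with
    | zero => rfl
    | succ d ih =>
      by_contra h
      have hle := hu (Nat.le_succ (sSup S + d))
      have : sSup S + (d + 1) ∈ S := ⟨by omega, by
        rw [show sSup S + (d + 1) - 1 = sSup S + d by omega]
        rw [← add_assoc] at h ⊢
        simp only [Nat.succ_eq_add_one] at hle
        omega⟩
      have := le_csSup hbdd this
      omega
  have htel : ∀ k, ((List.range k).map fun k => u (k + 1) - u k).sum = u k := by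
    intro k
    induction k with
    | zero => simpa using h0.symm
    | succ k ih =>
      have := hu (Nat.le_succ k)
      simp only [List.range_succ, List.map_append, List.sum_append, ih, List.map_cons,
        List.map_nil, List.sum_cons, List.sum_nil, Nat.succ_eq_add_one] at this ⊢
      omega
  rw [differenceShape, ← hS, ← List.map_take, List.take_range, htel]
  rcases le_total i (sSup S) with h | h
  · rw [min_eq_left h]
  · obtain ⟨d, rfl⟩ := Nat.exists_eq_add_of_le h
    rw [min_eq_right h, hconst]

theorem differenceShape_sum {u : ℕ → ℕ} (hu : Monotone u) (h0 : u 0 = 0) {N : ℕ}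
    (hN : ∀ k, N ≤ k → u k = u N) : (differenceShape u).sum = u N := by
  have h := differenceShape_take_sum hu h0 hN (N + (differenceShape u).length)
  rwa [List.take_of_length_le (by omega), hN _ (by omega)] at h

section

variable {P : Type*} [PartialOrder P] [Fintype P]

theorem maxChainUnion_mono : Monotone (maxChainUnion P) := by
  refine monotone_nat_of_le_succ fun k => ?_
  obtain ⟨C, hC, hk⟩ := exists_ncard_eq_maxChainUnion P k
  rw [← hk]
  refine le_trans (Set.ncard_le_ncard ?_) (ncard_le_maxChainUnion (Fin.snoc C ∅ : Fin (k + 1) → Set P)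
    (Fin.lastCases (by simp) (by simpa using hC)))
  exact Set.iUnion_subset fun i => Set.subset_iUnion_of_subset i.castSucc (by simp)

theorem maxAntichainUnion_mono : Monotone (maxAntichainUnion P) := by
  refine monotone_nat_of_le_succ fun k => ?_
  obtain ⟨C, hC, hk⟩ := exists_ncard_eq_maxAntichainUnion P k
  rw [← hk]
  refine le_trans (Set.ncard_le_ncard ?_) (ncard_le_maxAntichainUnion
    (Fin.snoc C ∅ : Fin (k + 1) → Set P) (Fin.lastCases (by simp) (by simpa using hC)))
  exact Set.iUnion_subset fun i => Set.subset_iUnion_of_subset i.castSucc (by simp)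

theorem maxChainUnion_zero : maxChainUnion P 0 = 0 := by
  obtain ⟨C, -, hk⟩ := exists_ncard_eq_maxChainUnion P 0
  simp [← hk]

theorem maxAntichainUnion_zero : maxAntichainUnion P 0 = 0 := by
  obtain ⟨C, -, hk⟩ := exists_ncard_eq_maxAntichainUnion P 0
  simp [← hk]

theorem maxChainUnion_of_card_le {k : ℕ} (hk : Fintype.card P ≤ k) :
    maxChainUnion P k = Fintype.card P := by
  refine le_antisymm ?_ (maxChainUnion_card.trans (maxChainUnion_mono hk))
  obtain ⟨C, -, hk⟩ := exists_ncard_eq_maxChainUnion P k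
  exact hk.ge.trans ((Set.ncard_le_card _).trans_eq Nat.card_eq_fintype_card)

theorem maxAntichainUnion_of_card_le {k : ℕ} (hk : Fintype.card P ≤ k) :
    maxAntichainUnion P k = Fintype.card P := by
  refine le_antisymm ?_ (maxAntichainUnion_card.trans (maxAntichainUnion_mono hk))
  obtain ⟨C, -, hk⟩ := exists_ncard_eq_maxAntichainUnion P k
  exact hk.ge.trans ((Set.ncard_le_card _).trans_eq Nat.card_eq_fintype_card)

theorem chainGreeneShape_take_sum (i : ℕ) :
    ((chainGreeneShape P).take i).sum = maxChainUnion P i :=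
  differenceShape_take_sum maxChainUnion_mono maxChainUnion_zero
    (fun _ hk => (maxChainUnion_of_card_le hk).trans (maxChainUnion_of_card_le le_rfl).symm) i

theorem antichainGreeneShape_take_sum (i : ℕ) :
    ((antichainGreeneShape P).take i).sum = maxAntichainUnion P i :=
  differenceShape_take_sum maxAntichainUnion_mono maxAntichainUnion_zero
    (fun _ hk => (maxAntichainUnion_of_card_le hk).trans
      (maxAntichainUnion_of_card_le le_rfl).symm) i

theorem chainGreeneShape_sum : (chainGreeneShape P).sum = Fintype.card P :=
  (differenceShape_sum maxChainUnion_mono maxChainUnion_zero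
    (fun _ hk => (maxChainUnion_of_card_le hk).trans
      (maxChainUnion_of_card_le le_rfl).symm)).trans (maxChainUnion_of_card_le le_rfl)

theorem antichainGreeneShape_sum : (antichainGreeneShape P).sum = Fintype.card P :=
  (differenceShape_sum maxAntichainUnion_mono maxAntichainUnion_zero
    (fun _ hk => (maxAntichainUnion_of_card_le hk).trans
      (maxAntichainUnion_of_card_le le_rfl).symm)).trans (maxAntichainUnion_of_card_le le_rfl)

end

/-! ### Words, contents and coefficients of quasisymmetric functions -/

/-- The exponent vector `∏ x_{f a}` of a map `f` to the positive integers. -/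
noncomputable def content {ι : Type*} [Fintype ι] (f : ι → ℕ+) : ℕ+ →₀ ℕ :=
  ∑ a, Finsupp.single (f a) 1

theorem content_apply {ι : Type*} [Fintype ι] (f : ι → ℕ+) (i : ℕ+) :
    content f i = Nat.card {a // f a = i} := by
  classical
  simp [content, Finsupp.finsetSum_apply, Finsupp.single_apply, Fintype.card_subtype]

theorem content_eq_iff {ι : Type*} [Fintype ι] (f : ι → ℕ+) (m : ℕ+ →₀ ℕ) :
    content f = m ↔ ∀ i, Nat.card {a // f a = i} = m i := by
  simp [Finsupp.ext_iff, content_apply]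

theorem content_comp_equiv {ι κ : Type*} [Fintype ι] [Fintype κ] (f : ι → ℕ+) (e : κ ≃ ι) :
    content (f ∘ e) = content f :=
  Equiv.sum_comp e fun a => Finsupp.single (f a) 1

theorem degree_content {ι : Type*} [Fintype ι] (f : ι → ℕ+) :
    (content f).degree = Fintype.card ι := by
  simp [content]

theorem content_eq_toFinsupp {n : ℕ} (g : Fin n → ℕ+) :
    content g = Multiset.toFinsupp (List.ofFn g : Multiset ℕ+) := by
  have : (List.ofFn g : Multiset ℕ+) = ∑ a, {g a} := by
    rw [List.ofFn_eq_map, ← Multiset.map_coe, ← Multiset.sum_map_singleton (Multiset.map g _),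
      Multiset.map_map]
    rfl
  rw [this, map_sum]
  simp [content]

theorem eq_of_monotone_of_content_eq {n : ℕ} {g h : Fin n → ℕ+} (hg : Monotone g)
    (hh : Monotone h) (H : content g = content h) : g = h := by
  rw [content_eq_toFinsupp, content_eq_toFinsupp] at H
  exact List.ofFn_injective ((Multiset.coe_eq_coe.1 (Multiset.toFinsupp.injective H)).eq_of_pairwise'
    hg.sortedLE_ofFn.pairwise hh.sortedLE_ofFn.pairwise)

/-- Reduces identities of power series to evaluation at sorted words. -/
theorem exists_monotone_content_eq (m : ℕ+ →₀ ℕ) :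
    ∃ (n : ℕ) (g : Fin n → ℕ+), Monotone g ∧ content g = m := by
  set l := (Finsupp.toMultiset m).toList
  refine ⟨_, l.get ∘ Tuple.sort l.get, Tuple.monotone_sort _, ?_⟩
  rw [content_comp_equiv, content_eq_toFinsupp, List.ofFn_get, Multiset.coe_toList]
  simp

/-- The set of cut points of a word at which it strictly increases. -/
def ascentSet {α : Type*} [LT α] {n : ℕ} (g : Fin n → α) : Set ℕ :=
  {j | ∃ (i : ℕ) (h : i + 1 < n), j = i + 1 ∧ g ⟨i, by omega⟩ < g ⟨i + 1, h⟩}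

/-- The set of cut points of a word at which it strictly decreases. -/
def descentSet {α : Type*} [LT α] {n : ℕ} (g : Fin n → α) : Set ℕ :=
  {j | ∃ (i : ℕ) (h : i + 1 < n), j = i + 1 ∧ g ⟨i + 1, h⟩ < g ⟨i, by omega⟩}

theorem descentSet_subset_Ioo {α : Type*} [LT α] {n : ℕ} (g : Fin n → α) :
    descentSet g ⊆ Set.Ioo 0 n := by
  rintro _ ⟨i, h, rfl, -⟩
  exact ⟨by omega, h⟩

theorem ascentSet_subset_Ioo {α : Type*} [LT α] {n : ℕ} (g : Fin n → α) :
    ascentSet g ⊆ Set.Ioo 0 n := by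
  rintro _ ⟨i, h, rfl, -⟩
  exact ⟨by omega, h⟩

/-- Consequently, monotone words with the same ascent set have the same strict comparisons between
positions. -/
theorem Monotone.lt_iff_exists_mem_ascentSet {α : Type*} [LinearOrder α] {n : ℕ} {g : Fin n → α}
    (hg : Monotone g) (a b : Fin n) :
    g a < g b ↔ ∃ j ∈ ascentSet g, (a : ℕ) < j ∧ j ≤ b := by
  constructor
  · obtain ⟨b, hb⟩ := b
    induction b with
    | zero => intro h; exact absurd (hg (Fin.mk_le_of_le_val (Nat.zero_le a))) h.not_ge
    | succ b ih =>
      intro h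
      by_cases hab : g a < g ⟨b, by omega⟩
      · obtain ⟨j, hj, h1, h2⟩ := ih _ hab
        exact ⟨j, hj, h1, Nat.le_succ_of_le h2⟩
      · refine ⟨b + 1, ⟨b, hb, rfl, (not_lt.1 hab).trans_lt h⟩, ?_, le_rfl⟩
        by_contra! hle
        exact h.not_ge (hg (Fin.mk_le_of_le_val hle))
  · rintro ⟨_, ⟨i, h, rfl, hlt⟩, h1, h2⟩
    exact (hg (Fin.le_def.2 (by simp; omega))).trans_lt (hlt.trans_le (hg (Fin.le_def.2 h2)))

theorem StrictMono.ascentSet_comp {α β : Type*} [LinearOrder α] [Preorder β] {n : ℕ}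
    {i : α → β} (hi : StrictMono i) (g : Fin n → α) : ascentSet (i ∘ g) = ascentSet g := by
  simp [ascentSet, hi.lt_iff_lt]

/-! ### Compositions as monotone words and as sets of cut points -/

namespace Composition

variable {n : ℕ} (α : Composition n)

theorem index_monotone : Monotone α.index := by
  intro a b hab
  by_contra! h
  have h1 := α.lt_sizeUpTo_index_succ b
  have h2 := α.sizeUpTo_index_le a
  have h3 := α.monotone_sizeUpTo (Nat.succ_le_of_lt (Fin.lt_def.1 h))
  simp only [Fin.val_succ, Nat.succ_eq_add_one, Fin.le_def] at *
  omega

theorem index_surjective : Function.Surjective α.index := fun i =>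
  ⟨_, α.index_embedding i ⟨0, α.one_le_blocksFun i⟩⟩

theorem ascentSet_index : ascentSet α.index = α.partialSumSet := by
  ext j
  simp only [partialSumSet, Finset.coe_image, Set.mem_image, Finset.coe_Ioo, Set.mem_Ioo]
  constructor
  · rintro ⟨i, hi, rfl, h⟩
    have h1 := α.lt_sizeUpTo_index_succ ⟨i, by omega⟩
    have h2 := α.sizeUpTo_index_le ⟨i + 1, hi⟩
    have h3 := α.monotone_sizeUpTo (Nat.succ_le_of_lt (Fin.lt_def.1 h))
    have h4 := (α.index ⟨i + 1, hi⟩).2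
    simp only [Fin.val_succ, Nat.succ_eq_add_one, Fin.lt_def] at *
    exact ⟨α.index ⟨i + 1, hi⟩, ⟨by omega, h4⟩, by omega⟩
  · rintro ⟨k, ⟨hk0, hk⟩, rfl⟩
    have h0 := α.sizeUpTo_strict_mono (i := 0) (by omega)
    have h1 := α.monotone_sizeUpTo (show 0 + 1 ≤ k by omega)
    have h2 := α.sizeUpTo_strict_mono hk
    have h3 := α.sizeUpTo_le (k + 1)
    refine ⟨α.sizeUpTo k - 1, by omega, by omega, ?_⟩
    rw [Fin.lt_def]
    refine lt_of_lt_of_le (b := k) ?_ ?_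
    · by_contra! h
      have h4 := α.monotone_sizeUpTo h
      have h5 := α.sizeUpTo_index_le ⟨α.sizeUpTo k - 1, by omega⟩
      simp only at h5
      omega
    · by_contra! h
      have h4 := α.monotone_sizeUpTo (Nat.succ_le_of_lt h)
      have h5 := α.lt_sizeUpTo_index_succ ⟨α.sizeUpTo k - 1 + 1, by omega⟩
      simp only [Fin.val_succ, Nat.succ_eq_add_one] at h4 h5
      omega

theorem partialSumSet_subset_Ioo : (α.partialSumSet : Set ℕ) ⊆ Set.Ioo 0 n :=
  α.ascentSet_index ▸ ascentSet_subset_Ioo _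

theorem mem_boundaries_iff_mem_partialSumSet (j : Fin (n + 1)) :
    j ∈ α.boundaries ↔ (j : ℕ) = 0 ∨ (j : ℕ) = n ∨ (j : ℕ) ∈ α.partialSumSet := by
  simp only [boundaries, boundary, partialSumSet, Finset.mem_map, Finset.mem_univ, true_and,
    Finset.mem_image, Finset.mem_Ioo]
  constructor
  · rintro ⟨k, rfl⟩
    rcases Nat.eq_zero_or_pos (k : ℕ) with h | h
    · left; simp [h]
    · rcases Nat.lt_or_ge k α.length with h' | h'
      · exact .inr (.inr ⟨k, ⟨h, h'⟩, rfl⟩)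
      · right; left
        exact α.sizeUpTo_ofLength_le _ h'
  · rintro (h | h | ⟨k, ⟨-, hk⟩, h⟩)
    · exact ⟨0, Fin.ext (by simp [h])⟩
    · exact ⟨Fin.last _, Fin.ext (by simp [h])⟩
    · exact ⟨⟨k, by omega⟩, Fin.ext h⟩

theorem partialSumSet_injective : Function.Injective (partialSumSet : Composition n → Finset ℕ) := by
  intro α β h
  refine (compositionEquiv n).injective (CompositionAsSet.ext ?_)
  ext j
  exact (α.mem_boundaries_iff_mem_partialSumSet j).trans
    (h ▸ (β.mem_boundaries_iff_mem_partialSumSet j).symm)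

theorem exists_partialSumSet_eq {T : Set ℕ} (hT : T ⊆ Set.Ioo 0 n) :
    ∃ α : Composition n, (α.partialSumSet : Set ℕ) = T := by
  classical
  let c : CompositionAsSet n :=
    { boundaries := {j | (j : ℕ) = 0 ∨ (j : ℕ) = n ∨ (j : ℕ) ∈ T}
      zero_mem := by simp
      getLast_mem := by simp }
  refine ⟨c.toComposition, Set.ext fun j => ?_⟩
  have key : ∀ hj : j < n + 1, (⟨j, hj⟩ : Fin (n + 1)) ∈ c.boundaries ↔ _ := fun hj =>
    c.toComposition_boundaries ▸ c.toComposition.mem_boundaries_iff_mem_partialSumSet ⟨j, hj⟩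
  constructor
  · intro h
    have h' := c.toComposition.partialSumSet_subset_Ioo h
    have := (key (by have := h'.2; omega)).2 (.inr (.inr h))
    simp only [c, Finset.mem_filter, Finset.mem_univ, true_and] at this
    have h1 := h'.1
    have h2 := h'.2
    rcases this with h | h | h
    · omega
    · omega
    · exact h
  · intro h
    have h1 := (hT h).1
    have h2 := (hT h).2
    rcases (key (by omega)).1 (by simp [c, h]) with h | h | h
    · simp only at h; omega
    · simp only at h; omega
    · exact h

theorem content_comp_index (i : Fin α.length → ℕ+) :
    content (i ∘ α.index) = ∑ j, Finsupp.single (i j) (α.blocksFun j) := by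
  rw [content, ← Equiv.sum_comp α.blocksFinEquiv, Fintype.sum_sigma]
  refine Finset.sum_congr rfl fun j _ => ?_
  have : ∀ k, α.index (α.blocksFinEquiv ⟨j, k⟩) = j := fun k => α.index_embedding j k
  simp [this]

theorem exists_strictMono_comp_index {g : Fin n → ℕ+} (hg : Monotone g)
    (h : ascentSet g = α.partialSumSet) :
    ∃ i : Fin α.length → ℕ+, StrictMono i ∧ i ∘ α.index = g := by
  have key : ∀ a b, g a < g b ↔ α.index a < α.index b := by
    intro a b
    rw [hg.lt_iff_exists_mem_ascentSet, α.index_monotone.lt_iff_exists_mem_ascentSet, h,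
      ascentSet_index]
  obtain ⟨s, hs⟩ := α.index_surjective.hasRightInverse
  refine ⟨g ∘ s, fun a b hab => (key _ _).2 (by rwa [hs, hs]), funext fun a => ?_⟩
  refine le_antisymm (not_lt.1 fun hlt => ?_) (not_lt.1 fun hlt => ?_)
  · exact ((key _ _).1 hlt).ne (hs _).symm
  · exact ((key _ _).1 hlt).ne (hs _)

end Composition

-- A contributing sequence `i` must satisfy `i ∘ α.index = g`; this determines `i`, and it is
-- solvable exactly when `g` jumps at the block ends of `α`.
open Classical in
theorem monomialQSym_content {n : ℕ} (α : Composition n) {g : Fin n → ℕ+} (hg : Monotone g) :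
    monomialQSym α (content g) = if ascentSet g = α.partialSumSet then 1 else 0 := by
  have key : ∀ i : Fin α.length → ℕ+, StrictMono i →
      ∑ j, Finsupp.single (i j) (α.blocksFun j) = content g → i ∘ α.index = g := fun i hi h =>
    eq_of_monotone_of_content_eq (hi.monotone.comp α.index_monotone) hg
      ((α.content_comp_index i).trans h)
  rw [monomialQSym]
  split_ifs with h
  · obtain ⟨i, hi, rfl⟩ := α.exists_strictMono_comp_index hg h
    rw [Nat.cast_eq_one, Nat.card_eq_one_iff_unique]
    refine ⟨⟨fun i j => ?_⟩, ⟨i, hi, (α.content_comp_index i).symm⟩⟩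
    exact Subtype.ext (α.index_surjective.injective_comp_right
      ((key i i.2.1 i.2.2).trans (key j j.2.1 j.2.2).symm))
  · rw [Nat.cast_eq_zero]
    refine @Nat.card_of_isEmpty _ ⟨fun ⟨i, hi, hm⟩ => h ?_⟩
    rw [← key i hi hm, hi.ascentSet_comp, α.ascentSet_index]

theorem degree_eq_of_monomialQSym_ne_zero {n : ℕ} (α : Composition n) {m : ℕ+ →₀ ℕ}
    (h : monomialQSym α m ≠ 0) : m.degree = n := by
  by_contra hne
  refine h ?_
  rw [monomialQSym, Nat.cast_eq_zero]
  refine @Nat.card_of_isEmpty _ ⟨fun ⟨i, hi, hm⟩ => hne ?_⟩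
  rw [← hm, ← α.content_comp_index, degree_content, Fintype.card_fin]

open Classical in
theorem fundamentalQSym_content {n : ℕ} (α : Σ n : ℕ, Composition n) {g : Fin n → ℕ+}
    (hg : Monotone g) :
    fundamentalQSym α.2 (content g) =
      if α.1 = n ∧ (α.2.partialSumSet : Set ℕ) ⊆ ascentSet g then 1 else 0 := by
  obtain ⟨N, α⟩ := α
  have hsum : fundamentalQSym α (content g) =
      ∑ β : Composition N with α.partialSumSet ⊆ β.partialSumSet, monomialQSym β (content g) := by
    change MvPowerSeries.coeff (content g) (fundamentalQSym α) = _
    rw [fundamentalQSym, map_sum]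
    rfl
  rw [hsum]
  by_cases hN : N = n
  · subst hN
    simp only [monomialQSym_content _ hg, true_and]
    -- Exactly one `M_β` is nonzero at `g`, the one whose cut points are the ascents of `g`.
    obtain ⟨β, hβ⟩ := Composition.exists_partialSumSet_eq (ascentSet_subset_Ioo g)
    simp only [← hβ, Finset.coe_inj, Composition.partialSumSet_injective.eq_iff,
      Finset.sum_ite_eq, Finset.coe_subset]
    simp
  · rw [if_neg (by simp [hN])]
    refine Finset.sum_eq_zero fun β _ => ?_
    by_contra h
    have := degree_eq_of_monomialQSym_ne_zero β h
    rw [degree_content, Fintype.card_fin] at this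
    exact hN this.symm

theorem exists_monotone_ascentSet_eq {n : ℕ} (α : Composition n) :
    ∃ g : Fin n → ℕ+, Monotone g ∧ ascentSet g = α.partialSumSet := by
  have hi : StrictMono fun j : Fin α.length => Nat.succPNat j := fun a b h => by
    simpa using h
  exact ⟨_, hi.monotone.comp α.index_monotone, by rw [hi.ascentSet_comp, α.ascentSet_index]⟩

open Classical in
theorem finsupp_sum_fundamentalQSym_content {n : ℕ} (c : (Σ n : ℕ, Composition n) →₀ ℚ)
    {g : Fin n → ℕ+} (hg : Monotone g) :
    (c.sum fun α r => r • fundamentalQSym α.2 : MvPowerSeries ℕ+ ℚ) (content g) =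
      c.sum fun α r => if α.1 = n ∧ (α.2.partialSumSet : Set ℕ) ⊆ ascentSet g then r else 0 := by
  refine (map_finsuppSum (MvPowerSeries.coeff (R := ℚ) (content g)) c
    fun α r => r • fundamentalQSym α.2).trans ?_
  refine Finsupp.sum_congr fun α _ => ?_
  rw [map_smul]
  change c α • fundamentalQSym α.2 (content g) = _
  rw [fundamentalQSym_content α hg]
  simp

/-- The fundamental quasisymmetric functions are linearly independent. -/
theorem IsFundamentalExpansion.unique {c d : (Σ n : ℕ, Composition n) →₀ ℚ}
    {K : MvPowerSeries ℕ+ ℚ} (hc : IsFundamentalExpansion c K) (hd : IsFundamentalExpansion d K) :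
    c = d := by
  classical
  suffices h : ∀ (s : ℕ) (α : Σ n : ℕ, Composition n), α.2.partialSumSet.card = s → (c - d) α = 0 by
    ext α
    simpa [sub_eq_zero] using h _ α rfl
  intro s
  induction s using Nat.strong_induction_on with
  | _ s ih =>
  rintro ⟨n, α⟩ rfl
  obtain ⟨g, hg, hgα⟩ := exists_monotone_ascentSet_eq α
  -- Triangularity: at a word with ascent set `S(α)` only the `β` with `S(β) ⊆ S(α)` survive, and
  -- the proper subsets are handled by induction.
  have h0 : (c - d).sum (fun β r =>
      if β.1 = n ∧ (β.2.partialSumSet : Set ℕ) ⊆ ascentSet g then r else 0) = 0 := by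
    rw [Finsupp.sum_sub_index fun β x y => by split_ifs <;> simp,
      ← finsupp_sum_fundamentalQSym_content c hg, ← finsupp_sum_fundamentalQSym_content d hg,
      ← hc, ← hd, sub_self]
  rw [Finsupp.sum, Finset.sum_eq_single ⟨n, α⟩] at h0
  · simpa [hgα] using h0
  · rintro ⟨N, β⟩ - hne
    split_ifs with h
    · obtain ⟨rfl, h⟩ := h
      rw [hgα, Finset.coe_subset] at h
      refine ih _ (Finset.card_lt_card (h.ssubset_of_ne fun he => hne ?_)) _ rfl
      exact congrArg (Sigma.mk _) (Composition.partialSumSet_injective he)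
    · rfl
  · intro h
    rw [Finsupp.notMem_support_iff.1 h, ite_self]

/-! ### The fundamental expansion of the enumerator of a naturally labeled poset -/

/-- Where `g` is constant it has no ascents, so `σ` has no descents there and increases step by
step. -/
theorem lt_of_descentSet_subset_ascentSet {n : ℕ} {α : Type*} [LinearOrder α] {g : Fin n → α}
    (hg : Monotone g) (σ : Equiv.Perm (Fin n)) (h : descentSet σ ⊆ ascentSet g)
    {i j : Fin n} (hij : i < j) (he : g i = g j) : σ i < σ j := by
  obtain ⟨j, hj⟩ := j
  induction j with
  | zero => exact absurd hij (by simp [Fin.lt_def])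
  | succ j ih =>
    have hij' : i ≤ ⟨j, by omega⟩ := Fin.le_def.2 (Nat.le_of_lt_succ (Fin.lt_def.1 hij))
    have hj' : (⟨j, by omega⟩ : Fin n) < ⟨j + 1, hj⟩ := Fin.lt_def.2 (Nat.lt_succ_self j)
    have hgj : g i = g ⟨j, by omega⟩ := le_antisymm (hg hij') (he ▸ hg hj'.le)
    have hstep : σ ⟨j, by omega⟩ < σ ⟨j + 1, hj⟩ := by
      by_contra! hle
      have hlt := lt_of_le_of_ne hle (σ.injective.ne hj'.ne')
      obtain ⟨j', _, h1, h2⟩ := h ⟨j, hj, rfl, hlt⟩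
      obtain rfl : j = j' := by omega
      exact h2.ne (hgj.symm.trans he)
    rcases hij'.eq_or_lt with heq | hlt
    · rwa [heq]
    · exact (ih _ hlt hgj).trans hstep

section

variable {P : Type*} [PartialOrder P] [Fintype P] {ω : P ≃ Fin (Fintype.card P)}

/-- The word `σ` lists the labels of a linear extension of `P`. -/
def IsLinearExtension (ω : P ≃ Fin (Fintype.card P)) (σ : Equiv.Perm (Fin (Fintype.card P))) :
    Prop :=
  ∀ a b : P, a < b → σ.symm (ω a) < σ.symm (ω b)

theorem IsNaturalLabeling.strictMono (hω : IsNaturalLabeling ω) : StrictMono ω := by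
  classical
  let := Fintype.toLocallyFiniteOrder (α := P)
  exact (strictMono_iff_forall_covBy ω).2 hω

theorem IsNaturalLabeling.isLinearExtension_one (hω : IsNaturalLabeling ω) :
    IsLinearExtension ω 1 :=
  fun _ _ h => hω.strictMono h

/-- The stable sort breaks ties by label, and labels increase along `P`; for the same reason the
strictness condition is vacuous. -/
theorem isPPartition_iff_isLinearExtension_sort (hω : IsNaturalLabeling ω) (f : P → ℕ+) :
    IsPPartition ω f ↔ IsLinearExtension ω (Tuple.sort (f ∘ ω.symm)) := by
  obtain ⟨h1, h2⟩ := Tuple.eq_sort_iff.1 (rfl : Tuple.sort (f ∘ ω.symm) = _)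
  set σ := Tuple.sort (f ∘ ω.symm)
  have hf : ∀ a, (f ∘ ω.symm ∘ σ) (σ.symm (ω a)) = f a := by simp
  constructor
  · intro h a b hab
    by_contra! hle
    have hba : f b ≤ f a := by rw [← hf a, ← hf b]; exact h1 hle
    have hne := σ.symm.injective.ne (ω.injective.ne hab.ne')
    have := h2 _ _ (lt_of_le_of_ne hle hne) ((hf b).trans ((hba.antisymm (h.1 a b hab)).trans
      (hf a).symm))
    simp only [Equiv.apply_symm_apply] at this
    exact this.asymm (hω.strictMono hab)
  · intro h
    refine ⟨fun a b hab => ?_, fun a b hab hlt => absurd hlt (hω.strictMono hab).asymm⟩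
    rw [← hf a, ← hf b]
    exact h1 (h a b hab).le

/-- The bijection sends `f` to the stable sort of its values in label order; its inverse writes the
letters of `g` along `σ`. Stability means that labels increase where letters agree, which is the
descent condition. -/
theorem partitionEnumerator_content (hω : IsNaturalLabeling ω) {g : Fin (Fintype.card P) → ℕ+}
    (hg : Monotone g) :
    partitionEnumerator ω (content g) =
      Nat.card {σ // IsLinearExtension ω σ ∧ descentSet σ ⊆ ascentSet g} := by
  rw [partitionEnumerator, Nat.cast_inj]
  have hword : ∀ f : P → ℕ+, content f = content g →
      (f ∘ ω.symm) ∘ Tuple.sort (f ∘ ω.symm) = g := fun f hf =>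
    eq_of_monotone_of_content_eq (Tuple.monotone_sort _) hg
      ((content_comp_equiv _ _).trans ((content_comp_equiv _ _).trans hf))
  have hsort : ∀ σ : Equiv.Perm (Fin (Fintype.card P)), descentSet σ ⊆ ascentSet g →
      Tuple.sort ((g ∘ σ.symm ∘ ω) ∘ ω.symm) = σ := fun σ hσ => by
    refine (Tuple.eq_sort_iff.2 ⟨?_, fun i j hij he => ?_⟩).symm
    · intro i j hij
      simpa using hg hij
    · exact lt_of_descentSet_subset_ascentSet hg σ hσ hij (by simpa using he)
  refine Nat.card_congr
    { toFun := fun f => ⟨Tuple.sort (f.1 ∘ ω.symm),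
        (isPPartition_iff_isLinearExtension_sort hω _).1 f.2.1, ?_⟩
      invFun := fun σ => ⟨g ∘ σ.1.symm ∘ ω,
        (isPPartition_iff_isLinearExtension_sort hω _).2 (by
          rw [hsort _ σ.2.2]; exact σ.2.1), (content_eq_iff _ _).1 ?_⟩
      left_inv := fun f => Subtype.ext (funext fun a => ?_)
      right_inv := fun σ => Subtype.ext (hsort _ σ.2.2) }
  · have hf := hword f.1 ((content_eq_iff _ _).2 f.2.2)
    rintro _ ⟨i, hi, rfl, hlt⟩
    refine ⟨i, hi, rfl, lt_of_le_of_ne (hg (by simp [Fin.le_def])) fun he => ?_⟩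
    rw [← hf] at he
    exact hlt.asymm ((Tuple.eq_sort_iff.1 rfl).2 _ _ (by simp [Fin.lt_def]) he)
  · exact (content_comp_equiv g (ω.trans σ.1.symm) :)
  · have hf := hword f.1 ((content_eq_iff _ _).2 f.2.2)
    simpa using (congrFun hf ((Tuple.sort (f.1 ∘ ω.symm)).symm (ω a))).symm

theorem partitionEnumerator_content_of_ne {n : ℕ} (hn : Fintype.card P ≠ n) (g : Fin n → ℕ+) :
    partitionEnumerator ω (content g) = 0 := by
  rw [partitionEnumerator, Nat.cast_eq_zero]
  refine @Nat.card_of_isEmpty _ ⟨fun ⟨f, _, hf⟩ => hn ?_⟩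
  have := congrArg Finsupp.degree ((content_eq_iff _ _).2 hf)
  simpa [degree_content] using this

/-- The descent composition of a word. -/
noncomputable def descentComposition {n : ℕ} (σ : Fin n → Fin n) : Composition n :=
  (Composition.exists_partialSumSet_eq (descentSet_subset_Ioo σ)).choose

theorem partialSumSet_descentComposition {n : ℕ} (σ : Fin n → Fin n) :
    ((descentComposition σ).partialSumSet : Set ℕ) = descentSet σ :=
  (Composition.exists_partialSumSet_eq (descentSet_subset_Ioo σ)).choose_spec

open Classical in
/-- The enumerator of `P` is the sum of the fundamental quasisymmetric functions of the descent
compositions of its linear extensions. -/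
theorem isFundamentalExpansion_sum_linearExtension (hω : IsNaturalLabeling ω) :
    IsFundamentalExpansion (∑ σ ∈ Finset.univ.filter (IsLinearExtension ω),
      Finsupp.single ⟨Fintype.card P, descentComposition σ⟩ 1) (partitionEnumerator ω) := by
  rw [IsFundamentalExpansion]
  funext m
  obtain ⟨n, g, hg, rfl⟩ := exists_monotone_content_eq m
  rw [finsupp_sum_fundamentalQSym_content _ hg, ← Finsupp.sum_finsetSum_index (by simp)
    (by intros; split_ifs <;> simp)]
  simp only [Finsupp.sum_single_index, ite_self, partialSumSet_descentComposition]
  by_cases hn : Fintype.card P = n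
  · subst hn
    rw [partitionEnumerator_content hω hg]
    simp [Fintype.card_subtype, Finset.filter_filter]
  · rw [partitionEnumerator_content_of_ne hn]
    simp [hn]

theorem mem_fundamentalSupport_iff (hω : IsNaturalLabeling ω) (α : Σ n : ℕ, Composition n) :
    α ∈ fundamentalSupport ω ↔
      ∃ σ, IsLinearExtension ω σ ∧ α = ⟨Fintype.card P, descentComposition σ⟩ := by
  classical
  have hexp := isFundamentalExpansion_sum_linearExtension hω
  have hcoeff : (∑ σ ∈ Finset.univ.filter (IsLinearExtension ω),
      Finsupp.single (⟨Fintype.card P, descentComposition σ⟩ : Σ n : ℕ, Composition n) (1 : ℚ)) α =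
      (Finset.univ.filter fun σ => IsLinearExtension ω σ ∧
        α = ⟨Fintype.card P, descentComposition σ⟩).card := by
    simp [Finsupp.finsetSum_apply, Finsupp.single_apply, Finset.filter_filter, eq_comm]
  have : α ∈ fundamentalSupport ω ↔ (∑ σ ∈ Finset.univ.filter (IsLinearExtension ω),
      Finsupp.single (⟨Fintype.card P, descentComposition σ⟩ : Σ n : ℕ, Composition n) (1 : ℚ)) α
        ≠ 0 :=
    ⟨fun ⟨c, hc, h⟩ => hc.unique hexp ▸ h, fun h => ⟨_, hexp, h⟩⟩
  rw [this, hcoeff, Nat.cast_ne_zero, Finset.card_ne_zero]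
  simp [Finset.filter_nonempty_iff]

/-! ### Descending runs and antichains -/

/-- Unions of `k` antichains arise from descending runs of linear extensions. -/
theorem exists_linearExtension_runs (ω : P ≃ Fin (Fintype.card P)) (hω : IsNaturalLabeling ω)
    (k : ℕ) : ∃ σ, IsLinearExtension ω σ ∧ ∃ I : Fin k → Set ℕ,
      (∀ i, (I i).OrdConnected ∧ I i ⊆ Set.Iio (Fintype.card P) ∧
        ∀ j, j ∈ I i → j + 1 ∈ I i → j + 1 ∈ descentSet σ) ∧
      (⋃ i, I i).ncard = maxAntichainUnion P k := by
  classical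
  obtain ⟨A, hA, hAk⟩ := exists_ncard_eq_maxAntichainUnion P k
  set U := ⋃ i, A i with hU
  -- `F x` consists of the chains of `U` weakly below `x`; their maximum size `h x` layers `U` into
  -- at most `k` antichains.
  let F : P → Finset (Finset P) := fun x => {C | IsChain (· ≤ ·) (C : Set P) ∧ ∀ c ∈ C, c ∈ U ∧ c ≤ x}
  have hF : ∀ {x C}, C ∈ F x ↔ IsChain (· ≤ ·) (C : Set P) ∧ ∀ c ∈ C, c ∈ U ∧ c ≤ x := by
    simp [F]
  let h : P → ℕ := fun x => (F x).sup Finset.card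
  have hmax : ∀ x, ∃ C ∈ F x, h x = C.card := fun x =>
    Finset.exists_mem_eq_sup _ ⟨∅, hF.2 (by simp [IsChain])⟩ _
  have hle : ∀ x, h x ≤ k := by
    intro x
    obtain ⟨C, hC, hx⟩ := hmax x
    rw [hx, ← Set.ncard_coe_finset, ← Set.inter_eq_left.2 (fun c hc => ((hF.1 hC).2 c hc).1 :
      (C : Set P) ⊆ U)]
    exact ncard_chain_inter_iUnion_antichain_le (hF.1 hC).1 A hA
  have hpos : ∀ x ∈ U, 1 ≤ h x := fun x hx =>
    Finset.le_sup (f := Finset.card) (b := {x}) (hF.2 (by simp [hx]))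
  have hmono : ∀ x y, x < y → h x ≤ h y := fun x y hxy =>
    Finset.sup_mono fun C hC => hF.2 ⟨(hF.1 hC).1, fun c hc =>
      ⟨((hF.1 hC).2 c hc).1, ((hF.1 hC).2 c hc).2.trans hxy.le⟩⟩
  have hstrict : ∀ x y, x < y → y ∈ U → h x < h y := by
    intro x y hxy hy
    obtain ⟨C, hC, hx⟩ := hmax x
    have hlt : ∀ c ∈ C, c < y := fun c hc => ((hF.1 hC).2 c hc).2.trans_lt hxy
    have hyC : y ∉ C := fun hc => (hlt y hc).false
    rw [hx, ← Nat.succ_le_iff, Nat.succ_eq_add_one, ← Finset.card_insert_of_notMem hyC]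
    refine Finset.le_sup (f := Finset.card) (hF.2 ⟨?_, ?_⟩)
    · rw [Finset.coe_insert]
      exact (hF.1 hC).1.insert fun c hc _ => .inr (hlt c hc).le
    · intro c hc
      rcases Finset.mem_insert.1 hc with rfl | hc
      · exact ⟨hy, le_rfl⟩
      · exact ⟨((hF.1 hC).2 c hc).1, (hlt c hc).le⟩
  -- Elements outside `U` go just after the elements of `U` of the same height. Sorting by `e`, with
  -- labels decreasing inside `U` and increasing outside, extends the order since `h` rises strictly
  -- on reaching an element of `U`.
  let e : P → ℕ := fun x => 2 * h x + if x ∈ U then 0 else 1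
  let s : P → ℤ := fun x => if x ∈ U then -((ω x : ℕ) : ℤ) else ((ω x : ℕ) : ℤ)
  let key : P → ℕ ×ₗ ℤ := fun x => toLex (e x, s x)
  have he : ∀ x i, e x = 2 * i ↔ x ∈ U ∧ h x = i := by
    intro x i
    by_cases hx : x ∈ U <;> simp only [e, hx, if_true, if_false, true_and, false_and, iff_false] <;> omega
  have hkey : Function.Injective key := by
    intro x y hxy
    have h1 : e x = e y := congrArg (fun z => (ofLex z).1) hxy
    have h2 : s x = s y := congrArg (fun z => (ofLex z).2) hxy
    refine ω.injective (Fin.ext ?_)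
    by_cases hx : x ∈ U <;> by_cases hy : y ∈ U <;>
      simp only [e, s, hx, hy, if_true, if_false] at h1 h2 <;> omega
  have hkeylt : ∀ x y, x < y → key x < key y := by
    intro x y hxy
    have h1 := hmono x y hxy
    have h2 := hstrict x y hxy
    have h3 := Fin.lt_def.1 (hω.strictMono hxy)
    refine Prod.Lex.toLex_lt_toLex.2 ?_
    by_cases hy : y ∈ U
    · left
      have := h2 hy
      simp only [e, hy, if_true]
      split_ifs <;> omega
    · by_cases hx : x ∈ U <;> simp only [e, s, hx, hy, if_true, if_false] <;> omega
  let σ := Tuple.sort (key ∘ ω.symm)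
  have hσ : StrictMono ((key ∘ ω.symm) ∘ σ) := (Tuple.monotone_sort _).strictMono_of_injective
    ((hkey.comp ω.symm.injective).comp σ.injective)
  let pos : P → Fin (Fintype.card P) := fun x => σ.symm (ω x)
  have hpos_lt : ∀ x y, pos x < pos y ↔ key x < key y := by
    intro x y
    rw [← hσ.lt_iff_lt]
    simp [pos]
  have hpos_le : ∀ x y, pos x ≤ pos y ↔ key x ≤ key y := by
    intro x y
    rw [← hσ.le_iff_le]
    simp [pos]
  have hpos_inj : Function.Injective fun x => (pos x : ℕ) :=
    Fin.val_injective.comp (σ.symm.injective.comp ω.injective)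
  refine ⟨σ, fun a b hab => (hpos_lt a b).2 (hkeylt a b hab),
    fun i => (fun x => (pos x : ℕ)) '' {x | e x = 2 * (i + 1)}, fun i => ⟨?_, ?_, ?_⟩, ?_⟩
  · rw [Set.ordConnected_def]
    rintro _ ⟨a, ha, rfl⟩ _ ⟨b, hb, rfl⟩ j ⟨hj1, hj2⟩
    have hj : j < Fintype.card P := hj2.trans_lt (pos b).2
    obtain ⟨c, rfl⟩ : ∃ c, (pos c : ℕ) = j := ⟨ω.symm (σ ⟨j, hj⟩), by simp [pos]⟩
    refine ⟨c, ?_, rfl⟩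
    have h1 := Prod.Lex.monotone_fst_ofLex ((hpos_le a c).1 (Fin.le_def.2 hj1))
    have h2 := Prod.Lex.monotone_fst_ofLex ((hpos_le c b).1 (Fin.le_def.2 hj2))
    exact le_antisymm (h2.trans_eq hb) (ha.ge.trans h1)
  · rintro _ ⟨a, -, rfl⟩
    exact (pos a).2
  · rintro _ ⟨a, ha, rfl⟩ ⟨b, hb, hab⟩
    have hlt : key a < key b := (hpos_lt a b).1 (Fin.lt_def.2 (by simp only at hab; omega))
    have haU := ((he a _).1 ha).1
    have hbU := ((he b _).1 hb).1
    refine ⟨pos a, hab ▸ (pos b).2, rfl, ?_⟩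
    rcases Prod.Lex.toLex_lt_toLex.1 hlt with h1 | ⟨-, h1⟩
    · exact absurd (ha.trans hb.symm) h1.ne
    · simp only [s, haU, hbU, if_true] at h1
      have h2 : (⟨pos a + 1, hab ▸ (pos b).2⟩ : Fin (Fintype.card P)) = pos b := Fin.ext hab.symm
      rw [h2]
      simp only [pos, Fin.eta, Equiv.apply_symm_apply, Fin.lt_def]
      omega
  · rw [← Set.image_iUnion, Set.ncard_image_of_injective _ hpos_inj, ← hAk]
    congr 1
    ext x
    simp only [Set.mem_iUnion, Set.mem_ofPred_eq, he]
    constructor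
    · rintro ⟨i, hx, -⟩
      exact hx
    · intro hx
      have h1 := hpos x hx
      have h2 := hle x
      -- Heights on `U` run from 1 to `k`, while runs are indexed from 0.
      exact ⟨⟨h x - 1, by omega⟩, hx, by simp only; omega⟩

/-- Descending runs of linear extensions are antichains. -/
theorem ncard_runs_le_maxAntichainUnion (hω : IsNaturalLabeling ω)
    {σ : Equiv.Perm (Fin (Fintype.card P))} (hσ : IsLinearExtension ω σ) {k : ℕ}
    (I : Fin k → Set ℕ) (hI : ∀ i, (I i).OrdConnected ∧ I i ⊆ Set.Iio (Fintype.card P) ∧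
      ∀ j, j ∈ I i → j + 1 ∈ I i → j + 1 ∈ descentSet σ) :
    (⋃ i, I i).ncard ≤ maxAntichainUnion P k := by
  -- Order-convexity of a run lets its adjacent descents be chained.
  have hdesc : ∀ i (a : Fin (Fintype.card P)) b (hb : b < Fintype.card P), (a : ℕ) ∈ I i →
      b ∈ I i → (a : ℕ) < b → σ ⟨b, hb⟩ < σ a := by
    intro i a b
    induction b with
    | zero => intro _ _ _ h; omega
    | succ b ih =>
      intro hb ha hbI hab
      have hbI' : b ∈ I i := (hI i).1.out ha hbI ⟨by omega, by omega⟩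
      obtain ⟨b', _, h1, h2⟩ := (hI i).2.2 b hbI' hbI
      obtain rfl : b = b' := by omega
      rcases (Nat.le_of_lt_succ hab).eq_or_lt with h | h
      · have heq : a = ⟨b, by omega⟩ := Fin.ext h
        rwa [heq]
      · exact h2.trans (ih _ ha hbI' h)
  let pos : P → ℕ := fun x => σ.symm (ω x)
  have hpos : Function.Injective pos :=
    Fin.val_injective.comp (σ.symm.injective.comp ω.injective)
  have hrange : (⋃ i, I i) ⊆ Set.range pos := Set.iUnion_subset fun i j hj =>
    ⟨ω.symm (σ ⟨j, (hI i).2.1 hj⟩), by simp [pos]⟩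
  rw [← Set.ncard_preimage_of_injective_subset_range hpos hrange, Set.preimage_iUnion]
  refine ncard_le_maxAntichainUnion _ fun i x hx y hy hne hle => ?_
  have hxy := lt_of_le_of_ne hle hne
  have := hdesc i (σ.symm (ω x)) (σ.symm (ω y)) (Fin.is_lt _) hx hy (hσ x y hxy)
  simp only [Fin.eta, Equiv.apply_symm_apply] at this
  exact this.asymm (hω.strictMono hxy)

end

/-! ### Comparison of the Greene shapes -/

theorem theorem3p9 {P Q : Type*} [PartialOrder P] [Fintype P] [PartialOrder Q] [Fintype Q]
    (ω : P ≃ Fin (Fintype.card P)) (τ : Q ≃ Fin (Fintype.card Q))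
    (hω : IsNaturalLabeling ω) (hτ : IsNaturalLabeling τ)
    (hsupp : fundamentalSupport ω ⊆ fundamentalSupport τ) :
    DominatedBy (antichainGreeneShape P) (antichainGreeneShape Q) ∧
      DominatedBy (chainGreeneShape Q) (chainGreeneShape P) := by
  have key : ∀ σ, IsLinearExtension ω σ → Fintype.card P = Fintype.card Q ∧
      ∃ ρ, IsLinearExtension τ ρ ∧ descentSet ρ = descentSet σ := by
    intro σ hσ
    obtain ⟨ρ, hρ, h⟩ := (mem_fundamentalSupport_iff hτ _).1
      (hsupp ((mem_fundamentalSupport_iff hω _).2 ⟨σ, hσ, rfl⟩))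
    have hS := congrArg (fun α : Σ n : ℕ, Composition n => (α.2.partialSumSet : Set ℕ)) h
    simp only [partialSumSet_descentComposition] at hS
    exact ⟨congrArg Sigma.fst h, ρ, hρ, hS.symm⟩
  have hcard := (key 1 hω.isLinearExtension_one).1
  have hanti : ∀ k, maxAntichainUnion P k ≤ maxAntichainUnion Q k := by
    intro k
    obtain ⟨σ, hσ, I, hI, hk⟩ := exists_linearExtension_runs ω hω k
    obtain ⟨-, ρ, hρ, hd⟩ := key σ hσ
    rw [← hk]
    -- The same runs serve for `ρ`, since they depend only on the descent set and the length.
    exact ncard_runs_le_maxAntichainUnion hτ hρ I (by rwa [hd, ← hcard])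
  refine ⟨⟨?_, fun i => ?_⟩, ⟨?_, fun i => ?_⟩⟩
  · rw [antichainGreeneShape_sum, antichainGreeneShape_sum, hcard]
  · rw [antichainGreeneShape_take_sum, antichainGreeneShape_take_sum]
    exact hanti i
  · rw [chainGreeneShape_sum, chainGreeneShape_sum, hcard]
  · rw [chainGreeneShape_take_sum, chainGreeneShape_take_sum]
    exact maxChainUnion_le_of_maxAntichainUnion_le hcard hanti i
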